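/- Let $\alpha\in\mathbb R\setminus\{0\}$, $\lambda\in\mathbb C$, and for $k\in(0,1)$ put $k'=\sqrt{1-k^2}$ and let $u$ be one of the two elliptic solutions of the mKdV equation $u_t+6u^2u_x+u_{xxx}=0$: * ($l=0$, cn-type) $u(x,t)=\alpha k\,\mathrm{cn}(\alpha\xi,k)$ with $\xi=x-st$, $s=\alpha^2(2k^2-1)$, and branch points $\hat\lambda_{1,\dots,4}=\frac{\mathrm i\alpha}{2}(\pm k\pm\mathrm i k')$; * ($l=\frac{K'}{2}$, dn-type) $u(x,t)=\alpha\,\mathrm{dn}(\alpha\xi,k)$ with $\xi=x-st$, $s=\alpha^2(2-k^2)$, and branch points $\hat\lambda_{1,\dots,4}=\pm\frac{\mathrm i\alpha}{2}(1\pm k')$. We also write $u(r)$ for the profile of $u$ as a function of $r=\xi$. Let $y=y(k)$ satisfy $y^2=\prod_{i=1}^4(\lambda-\hat\lambda_i)$ for all small $k>0$, and set $$\beta_1=2\lambda^2+\tfrac s2-2y,\quad \beta_2=2\lambda^2+\tfrac s2+2y,\quad \theta_{i}=\int_0^{\xi}\frac{2\mathrm i\lambda\beta_i}{u^2(r)-\beta_i}\,\mathrm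 dr+\mathrm i\lambda\xi\pm4\mathrm i\lambda yt\quad(i=1,2),$$ with the sign $+$ for $i=1$ and $-$ for $i=2$. Let $\Phi(x,t;\lambda)$ be the fundamental solution $$\Phi=\begin{bmatrix}\sqrt{u^2-\beta_1}\,\mathrm e^{\theta_1}&\sqrt{u^2-\beta_2}\,\mathrm e^{\theta_2}\\-\sqrt{u^2-\beta_2}\,\mathrm e^{-\theta_2}&-\sqrt{u^2-\beta_1}\,\mathrm e^{-\theta_1}\end{bmatrix}$$ of the Lax pair $\Phi_x=\mathbf U\Phi$, $\Phi_t=\mathbf V\Phi$, where $\sigma_3=\mathrm{diag}(1,-1)$, $\mathbf Q=\begin{bmatrix}0&u\\-u&0\end{bmatrix}$, $\mathbf U=-\mathrm i\lambda\sigma_3+\mathbf Q$ and $\mathbf V=-4\mathrm i\lambda^3\sigma_3+4\lambda^2\mathbf Q+\mathrm i\lambda\sigma_3(2\mathbf Q_x-2\mathbf Q^2)+2\mathbf Q^3-\mathbf Q_{xx}$. Here the branches of the square roots are functions of $\xi$ for which $\Phi$ solves the Lax pair, and the entries containing $\theta_i$ are given by the formula wherever $u^2(r)-\beta_i$ has no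 zero for $r$ between $0$ and $\xi$; elsewhere $\Phi$ is the continuation as a solution of the Lax pair. The root $\sqrt{u^2(0,0)-\beta_1}$ below is the same branch as in $\Phi$. (i) Let $l=0$ and $\lambda\ne\pm\frac\alpha2$, and let the branch $y$ be such that $y\to-(\lambda^2-\frac{\alpha^2}{4})$ as $k\to0^+$. Then $\Phi$ exists for all small $k>0$, and for every $(x,t)\in\mathbb R^2$ and every admissible choice of the roots $$\lim_{k\to0^+}\frac{\Phi(x,t;\lambda)\sigma_3}{\sqrt{u^2(0,0)-\beta_1}}=\begin{bmatrix}\mathrm e^{-\mathrm i\lambda x-4\mathrm i\lambda^3t}&0\\0&\mathrm e^{\mathrm i\lambda x+4\mathrm i\lambda^3t}\end{bmatrix}.$$ (ii) Let $l=\frac{K'}{2}$, let $\lambda\in\mathrm i\mathbb R$ with $|\lambda|>|\alpha|$, put $\nu=\sqrt{-\lambda^2-\alpha^2}>0$, and let the branch $y$ be such that $y\to\mathrm i\lambda\nu$ as $k\to0^+$. Then $\Phi$ exists for all small $k>0$, and for every $(x,t)\in\mathbb R^2$ and every admissible choice of the roots $$\lim_{k\to0^+}\frac{\Phi(x,t;\lambda)\sigma_3}{\sqrt{u^2(0,0)-\beta_1}}=\Psi(x,t;\lambda):=\begin{bmatrix}\mathrm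 e^{-\nu(x+2(2\lambda^2-\alpha^2)t)}&\dfrac{\alpha\,\mathrm e^{\nu(x+2(2\lambda^2-\alpha^2)t)}}{\nu+\mathrm i\lambda}\\[2mm]\dfrac{\alpha\,\mathrm e^{-\nu(x+2(2\lambda^2-\alpha^2)t)}}{\nu+\mathrm i\lambda}&\mathrm e^{\nu(x+2(2\lambda^2-\alpha^2)t)}\end{bmatrix}.$$ -/

import Mathlib

open Filter Topology

noncomputable section

namespace EllipticMKdV

/-! Jacobi elliptic functions of a real argument, with modulus `k ∈ (0, 1)`. -/

/-- The incomplete elliptic integral of the first kind, `∫₀^φ dθ / √(1 - k² sin² θ)`. -/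
def ellipticF (k φ : ℝ) : ℝ :=
  ∫ θ in (0 : ℝ)..φ, 1 / Real.sqrt (1 - k ^ 2 * Real.sin θ ^ 2)

/-- The Jacobi amplitude: for `0 < k < 1` the map `ellipticF k` is an increasing bijection
of the real line, and `am k` is its inverse. -/
def am (k : ℝ) : ℝ → ℝ := Function.invFun (ellipticF k)

/-- The Jacobi function `cn(v, k)`. -/
def cn (k v : ℝ) : ℝ := Real.cos (am k v)

/-- The Jacobi function `dn(v, k)`. -/
def dn (k v : ℝ) : ℝ := Real.sqrt (1 - k ^ 2 * Real.sin (am k v) ^ 2)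

/-! The elliptic background solutions of mKdV. -/

/-- The two elliptic backgrounds: `cnType` is the case `l = 0`, and `dnType` is the case
`l = K' / 2`. -/
inductive Background
  | cnType
  | dnType

/-- The complementary modulus `k' = √(1 - k²)`. -/
def kc (k : ℝ) : ℝ := Real.sqrt (1 - k ^ 2)

/-- The profile of the background as a function of `ξ = x - s t`:
`α k cn(α ξ, k)`, respectively `α dn(α ξ, k)`. -/
def profile : Background → ℝ → ℝ → ℝ → ℝ
  | .cnType, α, k, ξ => α * k * cn k (α * ξ)
  | .dnType, α, k, ξ => α * dn k (α * ξ)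

/-- The velocity `s`. -/
def speed : Background → ℝ → ℝ → ℝ
  | .cnType, α, k => α ^ 2 * (2 * k ^ 2 - 1)
  | .dnType, α, k => α ^ 2 * (2 - k ^ 2)

/-- The background solution `u(x, t)` of mKdV. -/
def bg (b : Background) (α k x t : ℝ) : ℝ := profile b α k (x - speed b α k * t)

/-! The Lax pair `Φ_x = U Φ`, `Φ_t = V Φ`. -/

def sigma3 : Matrix (Fin 2) (Fin 2) ℂ := !![1, 0; 0, -1]

/-- The off-diagonal matrix with entries `w` and `-w`: this is `Q` for `w = u`, `Q_x` for
`w = u_x` and `Q_xx` for `w = u_xx`. -/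
def matQ (w : ℝ) : Matrix (Fin 2) (Fin 2) ℂ := !![0, (w : ℂ); -(w : ℂ), 0]

def laxU (lam : ℂ) (u : ℝ) : Matrix (Fin 2) (Fin 2) ℂ :=
  (-(Complex.I * lam)) • sigma3 + matQ u

def laxV (lam : ℂ) (u ux uxx : ℝ) : Matrix (Fin 2) (Fin 2) ℂ :=
  (-(4 * Complex.I * lam ^ 3)) • sigma3 + (4 * lam ^ 2) • matQ u
    + (Complex.I * lam) • (sigma3 * ((2 : ℂ) • matQ ux - (2 : ℂ) • matQ u ^ 2))
    + (2 : ℂ) • matQ u ^ 3 - matQ uxx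

/-- `Φ` is a fundamental (everywhere invertible) matrix solution of the Lax pair of the
potential `u` at the spectral parameter `lam`. -/
structure IsLaxFundamental (u : ℝ → ℝ → ℝ) (lam : ℂ)
    (Φ : ℝ → ℝ → Matrix (Fin 2) (Fin 2) ℂ) : Prop where
  deriv_x : ∀ x t i j,
    HasDerivAt (fun x' => Φ x' t i j) ((laxU lam (u x t) * Φ x t) i j) x
  deriv_t : ∀ x t i j,
    HasDerivAt (fun t' => Φ x t' i j)
      ((laxV lam (u x t) (deriv (fun x' => u x' t) x)
        (iteratedDeriv 2 (fun x' => u x' t) x) * Φ x t) i j) t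
  det_ne_zero : ∀ x t, (Φ x t).det ≠ 0

/-! The algebraic curve and the quantities `β_i`, `θ_i`. -/

/-- The branch points `λ̂_1, …, λ̂_4`. -/
def branchPoint : Background → ℝ → ℝ → Fin 4 → ℂ
  | .cnType, α, k =>
      ![Complex.I * α / 2 * (-k + Complex.I * kc k), Complex.I * α / 2 * (k + Complex.I * kc k),
        Complex.I * α / 2 * (-k - Complex.I * kc k), Complex.I * α / 2 * (k - Complex.I * kc k)]
  | .dnType, α, k =>
      ![-(Complex.I * α / 2 * (1 - kc k)), Complex.I * α / 2 * (1 - kc k),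
        -(Complex.I * α / 2 * (1 + kc k)), Complex.I * α / 2 * (1 + kc k)]

/-- `(lam, y)` lies on the curve `y² = (λ - λ̂_1)(λ - λ̂_2)(λ - λ̂_3)(λ - λ̂_4)`. -/
def OnCurve (b : Background) (α k : ℝ) (lam y : ℂ) : Prop :=
  y ^ 2 = ∏ i, (lam - branchPoint b α k i)

/-- `2 λ² + s/2 - 2 y`. This is `β₁`; and `β₂` is obtained by changing the sign of `y`. -/
def beta (b : Background) (α k : ℝ) (lam y : ℂ) : ℂ :=
  2 * lam ^ 2 + (speed b α k : ℂ) / 2 - 2 * y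

/-- `∫₀^ξ 2 i λ β / (u² - β) + i λ ξ + 4 i λ y t` with `ξ = x - s t`. This is `θ₁`; and `θ₂` is
obtained by changing the sign of `y` (which also turns `β₁` into `β₂`). -/
def theta (b : Background) (α k : ℝ) (lam y : ℂ) (x t : ℝ) : ℂ :=
  (∫ r in (0 : ℝ)..(x - speed b α k * t),
      2 * Complex.I * lam * beta b α k lam y
        / ((profile b α k r : ℂ) ^ 2 - beta b α k lam y))
    + Complex.I * lam * ((x - speed b α k * t : ℝ) : ℂ) + 4 * Complex.I * lam * y * t

/-- The integrand of `theta` has no pole on the path from `0` to `ξ = x - s t`. -/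
def Regular (b : Background) (α k : ℝ) (lam y : ℂ) (x t : ℝ) : Prop :=
  ∀ r ∈ Set.uIcc 0 (x - speed b α k * t), (profile b α k r : ℂ) ^ 2 - beta b α k lam y ≠ 0

/-- `Φ` is the fundamental solution
`[√(u² - β₁) exp θ₁, √(u² - β₂) exp θ₂; -√(u² - β₂) exp (-θ₂), -√(u² - β₁) exp (-θ₁)]`
of the Lax pair of the background. Here `ρ₁`, `ρ₂` are the branches, as functions of `ξ`, of the
two square roots, and it is the Lax pair that selects them. The entries with index `i` are given
by the formula wherever `θ_i` is defined; elsewhere (past a zero of `u² - β_i`) they are determined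
as the continuation of the solution of the Lax pair. -/
structure IsPhi (b : Background) (α k : ℝ) (lam y : ℂ) (ρ₁ ρ₂ : ℝ → ℂ)
    (Φ : ℝ → ℝ → Matrix (Fin 2) (Fin 2) ℂ) : Prop where
  lax : IsLaxFundamental (bg b α k) lam Φ
  sq₁ : ∀ ξ, ρ₁ ξ ^ 2 = (profile b α k ξ : ℂ) ^ 2 - beta b α k lam y
  sq₂ : ∀ ξ, ρ₂ ξ ^ 2 = (profile b α k ξ : ℂ) ^ 2 - beta b α k lam (-y)
  diag : ∀ x t, Regular b α k lam y x t →
    Φ x t 0 0 = ρ₁ (x - speed b α k * t) * Complex.exp (theta b α k lam y x t) ∧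
    Φ x t 1 1 = -(ρ₁ (x - speed b α k * t) * Complex.exp (-theta b α k lam y x t))
  offDiag : ∀ x t, Regular b α k lam (-y) x t →
    Φ x t 0 1 = ρ₂ (x - speed b α k * t) * Complex.exp (theta b α k lam (-y) x t) ∧
    Φ x t 1 0 = -(ρ₂ (x - speed b α k * t) * Complex.exp (-theta b α k lam (-y) x t))

/-! The limits. -/

/-- `ν = √(-λ² - α²)`, principal square root. -/
def nu (α : ℝ) (lam : ℂ) : ℂ := (-lam ^ 2 - (α : ℂ) ^ 2) ^ (1 / 2 : ℂ)

/-- The limit in the case `l = 0`. -/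
def zeroBackgroundPsi (lam : ℂ) (x t : ℝ) : Matrix (Fin 2) (Fin 2) ℂ :=
  !![Complex.exp (-(Complex.I * lam * x) - 4 * Complex.I * lam ^ 3 * t), 0;
     0, Complex.exp (Complex.I * lam * x + 4 * Complex.I * lam ^ 3 * t)]

/-- The matrix `Ψ(x, t; λ)`, the limit in the case `l = K' / 2`. -/
def constBackgroundPsi (α : ℝ) (lam : ℂ) (x t : ℝ) : Matrix (Fin 2) (Fin 2) ℂ :=
  let ν := nu α lam
  let X : ℂ := x + 2 * (2 * lam ^ 2 - (α : ℂ) ^ 2) * t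
  !![Complex.exp (-(ν * X)), α * Complex.exp (ν * X) / (ν + Complex.I * lam);
     α * Complex.exp (-(ν * X)) / (ν + Complex.I * lam), Complex.exp (ν * X)]

/-- For a branch `y = y(k)` of the curve: for small `k > 0` the fundamental solution `Φ` exists,
and for every choice of the roots the normalised matrix `Φ σ₃ / √(u²(0,0) - β₁)`, with the same
root as in `Φ`, tends to `L` pointwise as `k → 0⁺`. -/
def NormalisedLimit (b : Background) (α : ℝ) (lam : ℂ) (y : ℝ → ℂ)
    (L : ℝ → ℝ → Matrix (Fin 2) (Fin 2) ℂ) : Prop :=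
  (∀ᶠ k in 𝓝[>] (0 : ℝ), ∃ ρ₁ ρ₂ Φ, IsPhi b α k lam (y k) ρ₁ ρ₂ Φ) ∧
  ∀ (ρ₁ ρ₂ : ℝ → ℝ → ℂ) (Φ : ℝ → ℝ → ℝ → Matrix (Fin 2) (Fin 2) ℂ),
    (∀ᶠ k in 𝓝[>] (0 : ℝ), IsPhi b α k lam (y k) (ρ₁ k) (ρ₂ k) (Φ k)) →
    ∀ x t, Tendsto (fun k => (ρ₁ k 0)⁻¹ • (Φ k x t * sigma3)) (𝓝[>] 0) (𝓝 (L x t))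

end EllipticMKdV

end

/-!
Write `p` for the profile of the background, `q = p'` and `h = u² - β₁ = p² - β₁`. The profile
satisfies `p'' = s p - 2 p³` and `p'² = s p² - p⁴ + E`, with a constant `E` for which
`β₁ β₂ = -E` on the curve; hence (`profileDeriv_sq_add`)

  `q² + 4 λ² p² = -(u² - β₁) (u² - β₂)`.

**Existence.** In the moving frame the `t`-part of the Lax pair is `V + s U`, which depends on `ξ`
alone and is conjugated by the flow of `U`; its eigenvalues are `± 4 i λ y`. Solving for its
eigenvectors eliminates `√(u² - β₂)` from the off-diagonal entries:
`Φ₂₁ / Φ₁₁ = (q + 2 i λ p) / h` and `Φ₁₂ / Φ₂₂ = -(q - 2 i λ p) / h`. In both limits `k → 0⁺` the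
profile converges uniformly on the whole line to a constant (`0`, respectively `α`), and `h`
converges uniformly to a nonzero number. So for small `k` the function `h` has no zeros at all,
and these expressions give a global solution `wave` in closed form, even where `u² - β₂` vanishes
(`wave_isLaxFundamental`). Its determinant is a nonzero multiple of `y`, and the limit of `y` is
not zero. The formula with `√(u² - β₂)` holds until `u² - β₂` has a zero, because
`Φ₂₁² exp (2 θ₂) / (u² - β₂)` is constant and `q(0) = 0` (`sq_waveProfile_one_zero`).

**Uniqueness.** For any admissible choice of the roots, `Φ₁₁ = ρ₁ exp θ₁` is continuous, so `ρ₁` is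
a continuous root of the zero-free function `h` and is determined by `ρ₁(0)`. The off-diagonal
entries are recovered from `Φ_x = U Φ`, since the zeros of `p` are simple. Therefore
`Φ = ρ₁(0) • wave` (`IsPhi.eq_smul_wave`).

**Limit.** The integrands in `wave` converge uniformly to constants, which yields the limit
`limitWave` in both cases at once (`normalisedLimit_limitWave`); it remains to simplify it with
`ν² = -λ² - α²`.
-/

noncomputable section

namespace EllipticMKdV

/-! ### Jacobi elliptic functions of a real argument -/

section Jacobi

variable {k : ℝ}

lemma one_sub_mul_sin_sq_pos (h0 : 0 < k) (h1 : k < 1) (θ : ℝ) :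
    0 < 1 - k ^ 2 * Real.sin θ ^ 2 := by
  nlinarith [Real.sin_sq_le_one θ, sq_nonneg k, sq_nonneg (Real.sin θ)]

lemma continuous_ellipticF_integrand (h0 : 0 < k) (h1 : k < 1) :
    Continuous fun θ : ℝ => 1 / Real.sqrt (1 - k ^ 2 * Real.sin θ ^ 2) := by
  refine continuous_const.div (by fun_prop) fun θ => ?_
  exact (Real.sqrt_pos.2 (one_sub_mul_sin_sq_pos h0 h1 θ)).ne'

lemma hasDerivAt_ellipticF (h0 : 0 < k) (h1 : k < 1) (φ : ℝ) :
    HasDerivAt (ellipticF k) (1 / Real.sqrt (1 - k ^ 2 * Real.sin φ ^ 2)) φ :=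
  (continuous_ellipticF_integrand h0 h1).integral_hasStrictDerivAt 0 φ |>.hasDerivAt

lemma strictMono_ellipticF (h0 : 0 < k) (h1 : k < 1) : StrictMono (ellipticF k) :=
  strictMono_of_hasDerivAt_pos (hasDerivAt_ellipticF h0 h1) fun φ =>
    one_div_pos.2 (Real.sqrt_pos.2 (one_sub_mul_sin_sq_pos h0 h1 φ))

/-- The derivative of `ellipticF k` is at least `1`, so `ellipticF k` dominates the identity
at both ends of the line. -/
lemma surjective_ellipticF (h0 : 0 < k) (h1 : k < 1) : Function.Surjective (ellipticF k) := by
  have hmono : Monotone fun φ => ellipticF k φ - φ := by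
    refine monotone_of_hasDerivAt_nonneg
      (fun φ => (hasDerivAt_ellipticF h0 h1 φ).sub (hasDerivAt_id φ)) fun φ => ?_
    have hpos := Real.sqrt_pos.2 (one_sub_mul_sin_sq_pos h0 h1 φ)
    have hle : Real.sqrt (1 - k ^ 2 * Real.sin φ ^ 2) ≤ 1 :=
      Real.sqrt_le_one.2 (by nlinarith [mul_nonneg (sq_nonneg k) (sq_nonneg (Real.sin φ))])
    simpa using (one_le_div hpos).2 hle
  have hF0 : ellipticF k 0 = 0 := by simp [ellipticF]
  refine Continuous.surjective
    (continuous_iff_continuousAt.2 fun φ => (hasDerivAt_ellipticF h0 h1 φ).continuousAt) ?_ ?_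
  · refine tendsto_atTop_mono' _ ?_ tendsto_id
    filter_upwards [eventually_ge_atTop 0] with φ hφ
    have := hmono hφ
    simp only [hF0] at this
    simp only [id]; linarith
  · refine tendsto_atBot_mono' _ ?_ tendsto_id
    filter_upwards [eventually_le_atBot 0] with φ hφ
    have := hmono hφ
    simp only [hF0] at this
    simp only [id]; linarith

lemma ellipticF_am (h0 : 0 < k) (h1 : k < 1) (v : ℝ) : ellipticF k (am k v) = v :=
  Function.rightInverse_invFun (surjective_ellipticF h0 h1) v

lemma am_ellipticF (h0 : 0 < k) (h1 : k < 1) (φ : ℝ) : am k (ellipticF k φ) = φ :=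
  Function.leftInverse_invFun (strictMono_ellipticF h0 h1).injective φ

lemma am_zero (h0 : 0 < k) (h1 : k < 1) : am k 0 = 0 := by
  simpa [ellipticF] using am_ellipticF h0 h1 0

lemma continuous_am (h0 : 0 < k) (h1 : k < 1) : Continuous (am k) := by
  refine Monotone.continuous_of_surjective (fun v w hvw => ?_)
    fun φ => ⟨_, am_ellipticF h0 h1 φ⟩
  rwa [← (strictMono_ellipticF h0 h1).le_iff_le, ellipticF_am h0 h1, ellipticF_am h0 h1]

lemma dn_pos (h0 : 0 < k) (h1 : k < 1) (v : ℝ) : 0 < dn k v :=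
  Real.sqrt_pos.2 (one_sub_mul_sin_sq_pos h0 h1 _)

lemma dn_sq (h0 : 0 < k) (h1 : k < 1) (v : ℝ) :
    dn k v ^ 2 = 1 - k ^ 2 * Real.sin (am k v) ^ 2 :=
  Real.sq_sqrt (one_sub_mul_sin_sq_pos h0 h1 _).le

lemma hasDerivAt_am (h0 : 0 < k) (h1 : k < 1) (v : ℝ) : HasDerivAt (am k) (dn k v) v := by
  have h := HasDerivAt.of_local_left_inverse (continuous_am h0 h1).continuousAt
    (hasDerivAt_ellipticF h0 h1 (am k v)) (one_div_pos.2 (dn_pos h0 h1 v)).ne'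
    (Eventually.of_forall fun w => ellipticF_am h0 h1 w)
  simpa [dn] using h

lemma hasDerivAt_dn (h0 : 0 < k) (h1 : k < 1) (v : ℝ) :
    HasDerivAt (dn k) (-(k ^ 2 * Real.sin (am k v) * Real.cos (am k v))) v := by
  have h := ((((hasDerivAt_am h0 h1 v).sin.pow 2).const_mul (k ^ 2)).const_sub 1).sqrt
    (one_sub_mul_sin_sq_pos h0 h1 (am k v)).ne'
  refine h.congr_deriv ?_
  have hd := (dn_pos h0 h1 v).ne'
  change _ / (2 * dn k v) = _
  field_simp
  push_cast
  ring

end Jacobi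

/-! ### The profiles as solutions of the stationary equation -/

/-- The derivative of `profile b α k`. -/
def profileDeriv : Background → ℝ → ℝ → ℝ → ℝ
  | .cnType, α, k, ξ => -(α ^ 2 * k * Real.sin (am k (α * ξ)) * dn k (α * ξ))
  | .dnType, α, k, ξ => -(α ^ 2 * k ^ 2 * Real.sin (am k (α * ξ)) * Real.cos (am k (α * ξ)))

/-- The constant of integration `p'² + p⁴ - s p²` of the profile `p`. -/
def energy : Background → ℝ → ℝ → ℝ
  | .cnType, α, k => α ^ 4 * k ^ 2 * (1 - k ^ 2)
  | .dnType, α, k => -(α ^ 4 * (1 - k ^ 2))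

section Profile

variable (b : Background) (α : ℝ) {k : ℝ}

lemma hasDerivAt_profile (h0 : 0 < k) (h1 : k < 1) (ξ : ℝ) :
    HasDerivAt (profile b α k) (profileDeriv b α k ξ) ξ := by
  have hl : HasDerivAt (fun ξ : ℝ => α * ξ) α ξ := by simpa using (hasDerivAt_id ξ).const_mul α
  cases b with
  | cnType =>
    refine (((hasDerivAt_am h0 h1 (α * ξ)).cos.comp ξ hl).const_mul (α * k)).congr_deriv ?_
    simp only [profileDeriv]; ring
  | dnType =>
    refine (((hasDerivAt_dn h0 h1 (α * ξ)).comp ξ hl).const_mul α).congr_deriv ?_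
    simp only [profileDeriv]; ring

lemma hasDerivAt_profileDeriv (h0 : 0 < k) (h1 : k < 1) (ξ : ℝ) :
    HasDerivAt (profileDeriv b α k)
      (speed b α k * profile b α k ξ - 2 * profile b α k ξ ^ 3) ξ := by
  have hl : HasDerivAt (fun ξ : ℝ => α * ξ) α ξ := by simpa using (hasDerivAt_id ξ).const_mul α
  have ha := (hasDerivAt_am h0 h1 (α * ξ)).comp ξ hl
  have hd := (hasDerivAt_dn h0 h1 (α * ξ)).comp ξ hl
  have hd2 := dn_sq h0 h1 (α * ξ)
  have hcs := Real.sin_sq_add_cos_sq (am k (α * ξ))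
  cases b with
  | cnType =>
    refine (((ha.sin.const_mul (α ^ 2 * k)).mul hd).neg).congr_deriv ?_
    simp only [profile, speed, cn, Function.comp_apply]
    linear_combination (-(α ^ 3 * k * Real.cos (am k (α * ξ)))) * hd2
      + 2 * α ^ 3 * k ^ 3 * Real.cos (am k (α * ξ)) * hcs
  | dnType =>
    refine (((ha.sin.const_mul (α ^ 2 * k ^ 2)).mul ha.cos).neg).congr_deriv ?_
    simp only [profile, speed, Function.comp_apply]
    linear_combination 2 * α ^ 3 * dn k (α * ξ) * hd2
      - α ^ 3 * k ^ 2 * dn k (α * ξ) * hcs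

lemma profileDeriv_sq (h0 : 0 < k) (h1 : k < 1) (ξ : ℝ) :
    profileDeriv b α k ξ ^ 2
      = speed b α k * profile b α k ξ ^ 2 - profile b α k ξ ^ 4 + energy b α k := by
  have hd2 := dn_sq h0 h1 (α * ξ)
  have hs : Real.cos (am k (α * ξ)) ^ 2 = 1 - Real.sin (am k (α * ξ)) ^ 2 := Real.cos_sq' _
  have hd4 : dn k (α * ξ) ^ 4 = (1 - k ^ 2 * Real.sin (am k (α * ξ)) ^ 2) ^ 2 := by
    rw [← hd2]; ring
  have hc4 : Real.cos (am k (α * ξ)) ^ 4 = (1 - Real.sin (am k (α * ξ)) ^ 2) ^ 2 := by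
    rw [← hs]; ring
  cases b <;> simp only [profileDeriv, profile, speed, energy, cn, neg_sq, mul_pow, hd2, hs, hd4,
    hc4] <;> ring

lemma profileDeriv_zero (h0 : 0 < k) (h1 : k < 1) : profileDeriv b α k 0 = 0 := by
  cases b <;> simp [profileDeriv, am_zero h0 h1]

lemma energy_ne_zero (hα : α ≠ 0) (h0 : 0 < k) (h1 : k < 1) : energy b α k ≠ 0 := by
  have : 1 - k ^ 2 ≠ 0 := by nlinarith
  cases b <;> simp [energy, hα, h0.ne', this]

lemma continuous_profile (h0 : 0 < k) (h1 : k < 1) : Continuous (profile b α k) :=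
  continuous_iff_continuousAt.2 fun ξ => (hasDerivAt_profile b α h0 h1 ξ).continuousAt

lemma continuous_profileDeriv (h0 : 0 < k) (h1 : k < 1) : Continuous (profileDeriv b α k) :=
  continuous_iff_continuousAt.2 fun ξ => (hasDerivAt_profileDeriv b α h0 h1 ξ).continuousAt

lemma deriv_bg (h0 : 0 < k) (h1 : k < 1) (x t : ℝ) :
    deriv (fun x' => bg b α k x' t) x = profileDeriv b α k (x - speed b α k * t) :=
  ((hasDerivAt_profile b α h0 h1 _).comp_sub_const x (speed b α k * t)).deriv

lemma iteratedDeriv_two_bg (h0 : 0 < k) (h1 : k < 1) (x t : ℝ) :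
    iteratedDeriv 2 (fun x' => bg b α k x' t) x
      = speed b α k * profile b α k (x - speed b α k * t)
        - 2 * profile b α k (x - speed b α k * t) ^ 3 := by
  rw [iteratedDeriv_succ, iteratedDeriv_one, funext fun x => deriv_bg b α h0 h1 x t]
  exact ((hasDerivAt_profileDeriv b α h0 h1 _).comp_sub_const x (speed b α k * t)).deriv

/-! ### The algebraic curve -/

lemma prod_sub_branchPoint (h0 : 0 < k) (h1 : k < 1) (lam : ℂ) :
    ∏ i, (lam - branchPoint b α k i)
      = lam ^ 4 + speed b α k / 2 * lam ^ 2 + (speed b α k : ℂ) ^ 2 / 16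
        + energy b α k / 4 := by
  have hk : (kc k : ℂ) ^ 2 = 1 - (k : ℂ) ^ 2 := by
    have : kc k ^ 2 = 1 - k ^ 2 := Real.sq_sqrt (by nlinarith)
    exact_mod_cast this
  have hk4 : (kc k : ℂ) ^ 4 = (1 - (k : ℂ) ^ 2) ^ 2 := by rw [← hk]; ring
  have hI := Complex.I_sq
  have hI4 := Complex.I_pow_four
  have hI6 : Complex.I ^ 6 = -1 := by rw [show 6 = 4 + 2 from rfl, pow_add, hI, hI4]; ring
  have hI8 : Complex.I ^ 8 = 1 := by rw [show 8 = 4 + 4 from rfl, pow_add, hI4]; ring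
  cases b <;>
  · simp only [Fin.prod_univ_four, branchPoint, Matrix.cons_val, speed, energy]
    push_cast
    ring_nf
    simp only [hI, hI4, hI6, hI8, hk, hk4]
    ring

variable {b α}

/-- The key identity: `p'² + 4 λ² p²` is, up to sign, the product of the two radicands. -/
lemma profileDeriv_sq_add (h0 : 0 < k) (h1 : k < 1) {lam y : ℂ} (hy : OnCurve b α k lam y)
    (ξ : ℝ) :
    (profileDeriv b α k ξ : ℂ) ^ 2 + 4 * lam ^ 2 * (profile b α k ξ : ℂ) ^ 2
      = -(((profile b α k ξ : ℂ) ^ 2 - beta b α k lam y)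
          * ((profile b α k ξ : ℂ) ^ 2 - beta b α k lam (-y))) := by
  have h : (profileDeriv b α k ξ : ℂ) ^ 2
      = speed b α k * (profile b α k ξ : ℂ) ^ 2 - (profile b α k ξ : ℂ) ^ 4 + energy b α k := by
    exact_mod_cast profileDeriv_sq b α h0 h1 ξ
  rw [OnCurve, prod_sub_branchPoint b α h0 h1] at hy
  simp only [beta]
  linear_combination h - 4 * hy

end Profile

/-! ### Phase and amplitude along the background -/

section Phase

variable {b : Background} {α k : ℝ} {lam y : ℂ}

/-- The radicand `u² - β₁`; changing the sign of `y` gives `u² - β₂`. -/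
def radicand (b : Background) (α k : ℝ) (lam y : ℂ) (ξ : ℝ) : ℂ :=
  (profile b α k ξ : ℂ) ^ 2 - beta b α k lam y

/-- The part of `θ` that depends on `ξ` alone. -/
def phase (b : Background) (α k : ℝ) (lam y : ℂ) (ξ : ℝ) : ℂ :=
  (∫ r in (0 : ℝ)..ξ, 2 * Complex.I * lam * beta b α k lam y / radicand b α k lam y r)
    + Complex.I * lam * ξ

/-- The continuous branch of `√((u²(ξ) - β₁) / (u²(0) - β₁))` that equals `1` at `ξ = 0`, as the
exponential of the integral of its logarithmic derivative. -/
def amplitude (b : Background) (α k : ℝ) (lam y : ℂ) (ξ : ℝ) : ℂ :=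
  Complex.exp (∫ r in (0 : ℝ)..ξ,
    (profile b α k r : ℂ) * profileDeriv b α k r / radicand b α k lam y r)

lemma theta_eq (x t : ℝ) :
    theta b α k lam y x t
      = phase b α k lam y (x - speed b α k * t) + 4 * Complex.I * lam * y * t := rfl

lemma phase_zero : phase b α k lam y 0 = 0 := by simp [phase]

lemma amplitude_zero : amplitude b α k lam y 0 = 1 := by simp [amplitude]

/-- The fundamental theorem of calculus for a quotient whose denominator may vanish
elsewhere, but not on the path of integration. -/
lemma hasDerivAt_integral_div {f g : ℝ → ℂ} (hf : Continuous f) (hg : Continuous g) {ξ : ℝ}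
    (hξ : ∀ r ∈ Set.uIcc 0 ξ, g r ≠ 0) :
    HasDerivAt (fun ξ => ∫ r in (0 : ℝ)..ξ, f r / g r) (f ξ / g ξ) ξ := by
  refine intervalIntegral.integral_hasDerivAt_right ?_ ?_ ?_
  · exact (hf.continuousOn.div hg.continuousOn hξ).intervalIntegrable
  · exact (hf.measurable.div hg.measurable).stronglyMeasurable.stronglyMeasurableAtFilter
  · exact hf.continuousAt.div hg.continuousAt (hξ ξ Set.right_mem_uIcc)

lemma eq_of_hasDerivAt_zero_uIcc {f : ℝ → ℂ} {ξ : ℝ}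
    (hf : ∀ r ∈ Set.uIcc 0 ξ, HasDerivAt f 0 r) : f ξ = f 0 := by
  have h := (convex_uIcc (0 : ℝ) ξ).norm_image_sub_le_of_norm_hasDerivWithin_le (C := 0)
    (fun r hr => (hf r hr).hasDerivWithinAt) (fun r _ => by simp)
    Set.left_mem_uIcc Set.right_mem_uIcc
  simpa [sub_eq_zero] using h

lemma hasDerivAt_ofReal_profile (h0 : 0 < k) (h1 : k < 1) (ξ : ℝ) :
    HasDerivAt (fun r => (profile b α k r : ℂ)) (profileDeriv b α k ξ) ξ :=
  (hasDerivAt_profile b α h0 h1 ξ).ofReal_comp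

lemma hasDerivAt_ofReal_profileDeriv (h0 : 0 < k) (h1 : k < 1) (ξ : ℝ) :
    HasDerivAt (fun r => (profileDeriv b α k r : ℂ))
      (speed b α k * profile b α k ξ - 2 * (profile b α k ξ : ℂ) ^ 3) ξ := by
  simpa using (hasDerivAt_profileDeriv b α h0 h1 ξ).ofReal_comp

lemma hasDerivAt_radicand (h0 : 0 < k) (h1 : k < 1) (ξ : ℝ) :
    HasDerivAt (radicand b α k lam y) (2 * profile b α k ξ * profileDeriv b α k ξ) ξ := by
  refine (((hasDerivAt_ofReal_profile h0 h1 ξ).pow 2).sub_const _).congr_deriv ?_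
  simp

lemma continuous_radicand (h0 : 0 < k) (h1 : k < 1) : Continuous (radicand b α k lam y) :=
  continuous_iff_continuousAt.2 fun ξ => (hasDerivAt_radicand h0 h1 ξ).continuousAt

lemma hasDerivAt_phase (h0 : 0 < k) (h1 : k < 1) {ξ : ℝ}
    (hξ : ∀ r ∈ Set.uIcc 0 ξ, radicand b α k lam y r ≠ 0) :
    HasDerivAt (phase b α k lam y)
      (Complex.I * lam * ((profile b α k ξ : ℂ) ^ 2 + beta b α k lam y)
        / radicand b α k lam y ξ) ξ := by
  have h := (hasDerivAt_integral_div
    (continuous_const (y := 2 * Complex.I * lam * beta b α k lam y))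
    (continuous_radicand h0 h1) hξ).add
    ((hasDerivAt_id ξ).ofReal_comp.const_mul (Complex.I * lam))
  refine h.congr_deriv ?_
  have hne := hξ ξ Set.right_mem_uIcc
  simp only [Complex.ofReal_one]
  field_simp
  simp only [radicand]; ring

lemma hasDerivAt_amplitude (h0 : 0 < k) (h1 : k < 1) {ξ : ℝ}
    (hξ : ∀ r ∈ Set.uIcc 0 ξ, radicand b α k lam y r ≠ 0) :
    HasDerivAt (amplitude b α k lam y)
      (amplitude b α k lam y ξ
        * (profile b α k ξ * profileDeriv b α k ξ / radicand b α k lam y ξ)) ξ :=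
  (hasDerivAt_integral_div (f := fun r => (profile b α k r : ℂ) * profileDeriv b α k r)
    ((Complex.continuous_ofReal.comp (continuous_profile b α h0 h1)).mul
      (Complex.continuous_ofReal.comp (continuous_profileDeriv b α h0 h1)))
    (continuous_radicand h0 h1) hξ).cexp

lemma amplitude_ne_zero (ξ : ℝ) : amplitude b α k lam y ξ ≠ 0 := Complex.exp_ne_zero _

lemma mem_uIcc_zero_trans {ξ r q : ℝ} (hr : r ∈ Set.uIcc 0 ξ) (hq : q ∈ Set.uIcc 0 r) :
    q ∈ Set.uIcc 0 ξ :=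
  Set.uIcc_subset_uIcc Set.left_mem_uIcc hr hq

lemma amplitude_sq (h0 : 0 < k) (h1 : k < 1) {ξ : ℝ}
    (hξ : ∀ r ∈ Set.uIcc 0 ξ, radicand b α k lam y r ≠ 0) :
    amplitude b α k lam y ξ ^ 2 * radicand b α k lam y 0 = radicand b α k lam y ξ := by
  have h : amplitude b α k lam y ξ ^ 2 / radicand b α k lam y ξ
      = amplitude b α k lam y 0 ^ 2 / radicand b α k lam y 0 := by
    refine eq_of_hasDerivAt_zero_uIcc
      (f := fun r => amplitude b α k lam y r ^ 2 / radicand b α k lam y r) fun r hr => ?_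
    have hne := hξ r hr
    refine (((hasDerivAt_amplitude h0 h1 fun q hq => hξ q (mem_uIcc_zero_trans hr hq)).pow 2).div
      (hasDerivAt_radicand h0 h1 r) hne).congr_deriv ?_
    simp only [Pi.pow_apply]
    field_simp
    push_cast
    ring
  have hne := hξ ξ Set.right_mem_uIcc
  have hne0 := hξ 0 Set.left_mem_uIcc
  rw [amplitude_zero] at h
  field_simp at h
  linear_combination h

end Phase

/-! ### The explicit solution of the Lax pair -/

section Explicit

variable {b : Background} {α k : ℝ} {lam y : ℂ}

/-- On a stationary profile `2 u³ + u_xx = s u`, so the cubic terms of `V` cancel in `V + s U`. -/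
lemma laxV_stationary (p q s : ℝ) :
    laxV lam p q (s * p - 2 * p ^ 3)
      = !![-(Complex.I * lam * (4 * lam ^ 2 + s - 2 * p ^ 2)), 4 * lam ^ 2 * p
            + 2 * Complex.I * lam * q;
          -(4 * lam ^ 2 * p) + 2 * Complex.I * lam * q,
            Complex.I * lam * (4 * lam ^ 2 + s - 2 * p ^ 2)] - (s : ℂ) • laxU lam p := by
  ext i j
  fin_cases i <;> fin_cases j <;>
    simp [laxV, laxU, matQ, sigma3, pow_succ] <;> ring

/-- The `ξ`-dependent factor of the fundamental solution, normalised by `√(u²(0) - β₁)`. Its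
columns are eigenvectors of `V + s U` with eigenvalues `± 4 i λ y`. The off-diagonal entries are
written without `√(u² - β₂)`, so that zeros of `u² - β₂` do no harm. -/
def waveProfile (b : Background) (α k : ℝ) (lam y : ℂ) (ξ : ℝ) : Matrix (Fin 2) (Fin 2) ℂ :=
  let p : ℂ := profile b α k ξ
  let q : ℂ := profileDeriv b α k ξ
  let h := radicand b α k lam y ξ
  let R := amplitude b α k lam y ξ
  let e := Complex.exp (phase b α k lam y ξ)
  let e' := Complex.exp (-phase b α k lam y ξ)
  !![R * e, (q - 2 * Complex.I * lam * p) / h * (R * e');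
     (q + 2 * Complex.I * lam * p) / h * (R * e), -(R * e')]

/-- The fundamental solution of the Lax pair, normalised by `√(u²(0) - β₁)`. -/
def wave (b : Background) (α k : ℝ) (lam y : ℂ) (x t : ℝ) : Matrix (Fin 2) (Fin 2) ℂ :=
  waveProfile b α k lam y (x - speed b α k * t)
    * Matrix.diagonal ![Complex.exp (4 * Complex.I * lam * y * t),
        Complex.exp (-(4 * Complex.I * lam * y * t))]

/-- The columns of `waveProfile` solve `Φ_ξ = U Φ`. For the off-diagonal entries this is the Riccati
equation of the quotient `(p' ± 2 i λ p) / (p² - β₁)`, which rests on `profileDeriv_sq_add`. -/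
lemma hasDerivAt_waveProfile (h0 : 0 < k) (h1 : k < 1) (hy : OnCurve b α k lam y)
    (hreg : ∀ r, radicand b α k lam y r ≠ 0) (ξ : ℝ) (i j : Fin 2) :
    HasDerivAt (fun ξ => waveProfile b α k lam y ξ i j)
      ((laxU lam (profile b α k ξ) * waveProfile b α k lam y ξ) i j) ξ := by
  have hR := hasDerivAt_amplitude (b := b) (α := α) (lam := lam) (y := y) h0 h1
    (ξ := ξ) fun r _ => hreg r
  have hφ := hasDerivAt_phase (b := b) (α := α) (lam := lam) (y := y) h0 h1
    (ξ := ξ) fun r _ => hreg r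
  have hp := hasDerivAt_ofReal_profile (b := b) (α := α) h0 h1 ξ
  have hq := hasDerivAt_ofReal_profileDeriv (b := b) (α := α) h0 h1 ξ
  have hh := hasDerivAt_radicand (b := b) (α := α) (lam := lam) (y := y) h0 h1 ξ
  have hkey := profileDeriv_sq_add h0 h1 hy ξ
  have hne := hreg ξ
  have hdef : beta b α k lam y = (profile b α k ξ : ℂ) ^ 2 - radicand b α k lam y ξ := by
    simp [radicand]
  have hspeed : (speed b α k : ℂ)
      = beta b α k lam y + beta b α k lam (-y) - 4 * lam ^ 2 := by simp only [beta]; ring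
  have hI := Complex.I_sq
  rw [hdef] at hφ hkey hspeed
  generalize beta b α k lam (-y) = β₂ at *
  have he := hφ.cexp
  have he' := hφ.neg.cexp
  simp only [Pi.neg_apply] at he'
  fin_cases i <;> fin_cases j
  · refine (hR.mul he).congr_deriv ?_
    simp only [laxU, matQ, sigma3, waveProfile, Matrix.mul_apply, Fin.sum_univ_two]
    simp
    field_simp
    ring
  · refine (((hq.sub (hp.const_mul (2 * Complex.I * lam))).div hh hne).mul
      (hR.mul he')).congr_deriv ?_
    simp only [laxU, matQ, sigma3, waveProfile, Matrix.mul_apply, Fin.sum_univ_two]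
    simp
    rw [hspeed]
    field_simp
    linear_combination amplitude b α k lam y ξ * (-(profile b α k ξ : ℂ) * hkey
      + 4 * lam ^ 2 * profile b α k ξ
        * ((profile b α k ξ : ℂ) ^ 2 - radicand b α k lam y ξ) * hI)
  · refine (((hq.add (hp.const_mul (2 * Complex.I * lam))).div hh hne).mul
      (hR.mul he)).congr_deriv ?_
    simp only [laxU, matQ, sigma3, waveProfile, Matrix.mul_apply, Fin.sum_univ_two]
    simp
    rw [hspeed]
    field_simp
    linear_combination amplitude b α k lam y ξ * (-(profile b α k ξ : ℂ) * hkey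
      + 4 * lam ^ 2 * profile b α k ξ
        * ((profile b α k ξ : ℂ) ^ 2 - radicand b α k lam y ξ) * hI)
  · refine (hR.mul he').neg.congr_deriv ?_
    simp only [laxU, matQ, sigma3, waveProfile, Matrix.mul_apply, Fin.sum_univ_two]
    simp
    field_simp
    ring

/-- The columns of `waveProfile` are eigenvectors of `V + s U`. -/
lemma laxV_mul_waveProfile (h0 : 0 < k) (h1 : k < 1) (hy : OnCurve b α k lam y)
    {ξ : ℝ} (hne : radicand b α k lam y ξ ≠ 0) :
    laxV lam (profile b α k ξ) (profileDeriv b α k ξ)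
        (speed b α k * profile b α k ξ - 2 * profile b α k ξ ^ 3) * waveProfile b α k lam y ξ
      = waveProfile b α k lam y ξ
          * Matrix.diagonal ![4 * Complex.I * lam * y, -(4 * Complex.I * lam * y)]
        - (speed b α k : ℂ) • (laxU lam (profile b α k ξ) * waveProfile b α k lam y ξ) := by
  rw [laxV_stationary, Matrix.sub_mul, Matrix.smul_mul]
  congr 1
  have hkey := profileDeriv_sq_add h0 h1 hy ξ
  have hspeed : (speed b α k : ℂ)
      = 2 * beta b α k lam y - 4 * lam ^ 2 + 4 * y := by simp only [beta]; ring
  have hβ₂ : beta b α k lam (-y) = beta b α k lam y + 4 * y := by simp only [beta]; ring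
  have hdef : beta b α k lam y = (profile b α k ξ : ℂ) ^ 2 - radicand b α k lam y ξ := by
    simp [radicand]
  have hI := Complex.I_sq
  rw [hβ₂, hdef] at hkey
  rw [hspeed, hdef]
  ext i j
  fin_cases i <;> fin_cases j <;>
    simp [waveProfile, Matrix.mul_apply, Fin.sum_univ_two, Matrix.diagonal] <;>
    field_simp
  · linear_combination lam * amplitude b α k lam y ξ
      * (2 * Complex.I * hkey + 4 * lam * profile b α k ξ * profileDeriv b α k ξ * hI)
  · linear_combination lam * amplitude b α k lam y ξ
      * (-(4 * lam * profile b α k ξ * radicand b α k lam y ξ) * hI)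
  · linear_combination lam * amplitude b α k lam y ξ
      * (-(4 * lam * profile b α k ξ * radicand b α k lam y ξ) * hI)
  · linear_combination lam * amplitude b α k lam y ξ
      * (2 * Complex.I * hkey - 4 * lam * profile b α k ξ * profileDeriv b α k ξ * hI)

end Explicit

/-! ### Existence of the fundamental solution -/

section Existence

variable {b : Background} {α k : ℝ} {lam y : ℂ}

lemma det_waveProfile (h0 : 0 < k) (h1 : k < 1) (hy : OnCurve b α k lam y) {ξ : ℝ}
    (hne : radicand b α k lam y ξ ≠ 0) :
    (waveProfile b α k lam y ξ).det
      = -(4 * y) * amplitude b α k lam y ξ ^ 2 / radicand b α k lam y ξ := by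
  have hkey := profileDeriv_sq_add h0 h1 hy ξ
  have hβ₂ : beta b α k lam (-y) = beta b α k lam y + 4 * y := by simp only [beta]; ring
  have hdef : beta b α k lam y = (profile b α k ξ : ℂ) ^ 2 - radicand b α k lam y ξ := by
    simp [radicand]
  rw [hβ₂, hdef] at hkey
  have hI := Complex.I_sq
  simp only [waveProfile, Matrix.det_fin_two_of, Complex.exp_neg]
  have he := Complex.exp_ne_zero (phase b α k lam y ξ)
  field_simp
  linear_combination amplitude b α k lam y ξ ^ 2
    * (-hkey + 4 * lam ^ 2 * (profile b α k ξ : ℂ) ^ 2 * hI)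

lemma wave_apply (x t : ℝ) (i j : Fin 2) :
    wave b α k lam y x t i j = waveProfile b α k lam y (x - speed b α k * t) i j
      * Complex.exp ((![4 * Complex.I * lam * y, -(4 * Complex.I * lam * y)] : Fin 2 → ℂ) j
          * t) := by
  rw [wave, Matrix.mul_diagonal]
  fin_cases j <;> simp

lemma wave_isLaxFundamental (h0 : 0 < k) (h1 : k < 1) (hy : OnCurve b α k lam y) (hy0 : y ≠ 0)
    (hreg : ∀ r, radicand b α k lam y r ≠ 0) :
    IsLaxFundamental (bg b α k) lam (wave b α k lam y) where
  deriv_x x t i j := by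
    have h := (hasDerivAt_waveProfile h0 h1 hy hreg (x - speed b α k * t) i j).comp_sub_const x
      (speed b α k * t)
    rw [wave, ← Matrix.mul_assoc, Matrix.mul_diagonal]
    simp only [wave, Matrix.mul_diagonal]
    exact h.mul_const _
  deriv_t x t i j := by
    set μ : Fin 2 → ℂ := ![4 * Complex.I * lam * y, -(4 * Complex.I * lam * y)] with hμ
    have hξ : HasDerivAt (fun t' : ℝ => x - speed b α k * t') (-speed b α k) t := by
      simpa using ((hasDerivAt_id t).const_mul (speed b α k)).const_sub x
    have h := (hasDerivAt_waveProfile h0 h1 hy hreg (x - speed b α k * t) i j).scomp t hξ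
    have he := ((hasDerivAt_id t).ofReal_comp.const_mul (μ j)).cexp
    have hV := congrFun (congrFun (laxV_mul_waveProfile h0 h1 hy (hreg (x - speed b α k * t))) i) j
    rw [deriv_bg b α h0 h1, iteratedDeriv_two_bg b α h0 h1, wave, ← Matrix.mul_assoc,
      Matrix.mul_diagonal]
    simp only [wave_apply]
    refine (h.mul he).congr_deriv ?_
    rw [show laxV lam (bg b α k x t) = laxV lam (profile b α k (x - speed b α k * t)) from rfl, hV,
      Matrix.sub_apply, Matrix.mul_diagonal, Matrix.smul_apply]
    simp only [← hμ, id, Function.comp_apply, Complex.real_smul, smul_eq_mul, Complex.ofReal_neg,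
      Complex.ofReal_one]
    have hd : (![Complex.exp (4 * Complex.I * lam * y * t),
        Complex.exp (-(4 * Complex.I * lam * y * t))] : Fin 2 → ℂ) j
        = Complex.exp (μ j * t) := by
      rw [hμ]; fin_cases j <;> simp
    rw [hd]
    ring
  det_ne_zero x t := by
    rw [wave, Matrix.det_mul, det_waveProfile h0 h1 hy (hreg _), Matrix.det_diagonal]
    simp [Fin.prod_univ_two, Complex.exp_ne_zero, hy0, hreg, amplitude_ne_zero]

lemma IsLaxFundamental.const_smul {u : ℝ → ℝ → ℝ} {Φ : ℝ → ℝ → Matrix (Fin 2) (Fin 2) ℂ}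
    (h : IsLaxFundamental u lam Φ) {c : ℂ} (hc : c ≠ 0) :
    IsLaxFundamental u lam fun x t => c • Φ x t where
  deriv_x x t i j := by
    simpa only [Matrix.mul_smul, Matrix.smul_apply, smul_eq_mul]
      using (h.deriv_x x t i j).const_mul c
  deriv_t x t i j := by
    simpa only [Matrix.mul_smul, Matrix.smul_apply, smul_eq_mul]
      using (h.deriv_t x t i j).const_mul c
  det_ne_zero x t := by
    rw [Matrix.det_smul]
    exact mul_ne_zero (pow_ne_zero _ hc) (h.det_ne_zero x t)

lemma wave_diag (x t : ℝ) :
    wave b α k lam y x t 0 0 = amplitude b α k lam y (x - speed b α k * t)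
        * Complex.exp (theta b α k lam y x t) ∧
    wave b α k lam y x t 1 1 = -(amplitude b α k lam y (x - speed b α k * t)
        * Complex.exp (-theta b α k lam y x t)) := by
  simp only [wave_apply, theta_eq, waveProfile, Complex.exp_add, neg_add]
  simp
  ring_nf
  simp

lemma mul_offDiag_waveProfile (h0 : 0 < k) (h1 : k < 1) (hy : OnCurve b α k lam y) {ξ : ℝ}
    (hξ : ∀ r ∈ Set.uIcc 0 ξ, radicand b α k lam y r ≠ 0) :
    waveProfile b α k lam y ξ 0 1 * waveProfile b α k lam y ξ 1 0 * radicand b α k lam y 0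
      = -radicand b α k lam (-y) ξ := by
  have hkey := profileDeriv_sq_add h0 h1 hy ξ
  have hR := amplitude_sq h0 h1 hξ
  have hne := hξ ξ Set.right_mem_uIcc
  have hne0 := hξ 0 Set.left_mem_uIcc
  change _ = -(radicand b α k lam y ξ * radicand b α k lam (-y) ξ) at hkey
  have hI := Complex.I_sq
  have he := Complex.exp_ne_zero (phase b α k lam y ξ)
  simp only [waveProfile, Complex.exp_neg]
  simp
  field_simp
  linear_combination (amplitude b α k lam y ξ ^ 2 * radicand b α k lam y 0)
    * (hkey - 4 * lam ^ 2 * (profile b α k ξ : ℂ) ^ 2 * hI)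
    - radicand b α k lam y ξ * radicand b α k lam (-y) ξ * hR

/-- As long as `u² - β₂` has no zero between `0` and `ξ`, the off-diagonal entries of the explicit
solution are given by the formula with a root of `u² - β₂`: the quotient of `(Φ₂₁ exp θ₂)²` by
`u² - β₂` is constant, and its value at `ξ = 0` is computed with the help of `u'(0) = 0`. -/
lemma sq_waveProfile_one_zero (h0 : 0 < k) (h1 : k < 1) (hy : OnCurve b α k lam y)
    (hreg : ∀ r, radicand b α k lam y r ≠ 0) {ξ : ℝ}
    (hξ : ∀ r ∈ Set.uIcc 0 ξ, radicand b α k lam (-y) r ≠ 0) :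
    radicand b α k lam y 0
        * (waveProfile b α k lam y ξ 1 0 * Complex.exp (phase b α k lam (-y) ξ)) ^ 2
      = radicand b α k lam (-y) ξ := by
  have h : (waveProfile b α k lam y ξ 1 0 * Complex.exp (phase b α k lam (-y) ξ)) ^ 2
        / radicand b α k lam (-y) ξ
      = (waveProfile b α k lam y 0 1 0 * Complex.exp (phase b α k lam (-y) 0)) ^ 2
        / radicand b α k lam (-y) 0 := by
    refine eq_of_hasDerivAt_zero_uIcc (f := fun r =>
      (waveProfile b α k lam y r 1 0 * Complex.exp (phase b α k lam (-y) r)) ^ 2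
        / radicand b α k lam (-y) r) fun r hr => ?_
    have hne := hξ r hr
    have hne1 := hreg r
    have hF := hasDerivAt_waveProfile h0 h1 hy hreg r 1 0
    have hφ := (hasDerivAt_phase h0 h1 fun q hq => hξ q (mem_uIcc_zero_trans hr hq)).cexp
    refine (((hF.mul hφ).pow 2).div (hasDerivAt_radicand h0 h1 r) hne).congr_deriv ?_
    have hkey := profileDeriv_sq_add h0 h1 hy r
    change _ = -(radicand b α k lam y r * radicand b α k lam (-y) r) at hkey
    have hdef : beta b α k lam (-y)
        = (profile b α k r : ℂ) ^ 2 - radicand b α k lam (-y) r := by simp [radicand]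
    have hI := Complex.I_sq
    rw [hdef]
    simp only [laxU, matQ, sigma3, waveProfile, Matrix.mul_apply, Fin.sum_univ_two, Pi.pow_apply,
      Pi.mul_apply]
    simp
    field_simp
    refine Or.inl ?_
    linear_combination 2 * (profileDeriv b α k r + 2 * Complex.I * lam * profile b α k r)
      * amplitude b α k lam y r ^ 2 * Complex.exp (phase b α k lam y r) ^ 2
      * Complex.exp (phase b α k lam (-y) r) ^ 2
      * (-(profile b α k r : ℂ) * hkey + 4 * lam ^ 2 * (profile b α k r : ℂ) ^ 3 * hI)
  have hkey := profileDeriv_sq_add h0 h1 hy 0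
  change _ = -(radicand b α k lam y 0 * radicand b α k lam (-y) 0) at hkey
  have hne := hξ ξ Set.right_mem_uIcc
  have hne0 := hξ 0 Set.left_mem_uIcc
  have hne1 := hreg 0
  have hI := Complex.I_sq
  rw [profileDeriv_zero b α h0 h1, Complex.ofReal_zero] at hkey
  have hF0 : waveProfile b α k lam y 0 1 0
      = 2 * Complex.I * lam * profile b α k 0 / radicand b α k lam y 0 := by
    simp [waveProfile, profileDeriv_zero b α h0 h1, phase_zero, amplitude_zero]
  rw [hF0, phase_zero, Complex.exp_zero, div_eq_div_iff hne hne0] at h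
  rw [← mul_left_inj' (mul_ne_zero hne0 hne1)]
  field_simp at h
  linear_combination h + 4 * lam ^ 2 * (profile b α k 0 : ℂ) ^ 2 * radicand b α k lam (-y) ξ * hI
    - radicand b α k lam (-y) ξ * hkey

/-- If `u² - β₁` has no zero, the multiple of `wave` by a root of `u²(0) - β₁` is the
fundamental solution. -/
lemma isPhi_smul_wave (h0 : 0 < k) (h1 : k < 1) (hy : OnCurve b α k lam y) (hy0 : y ≠ 0)
    (hreg : ∀ r, radicand b α k lam y r ≠ 0) {c : ℂ} (hc : c ^ 2 = radicand b α k lam y 0) :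
    ∃ ρ₁ ρ₂, IsPhi b α k lam y ρ₁ ρ₂ fun x t => c • wave b α k lam y x t := by
  have hc0 : c ≠ 0 := by
    rintro rfl
    exact hreg 0 (by simpa using hc.symm)
  have hroot : ∀ ξ, ∃ ρ : ℂ, ρ ^ 2 = radicand b α k lam (-y) ξ ∧
      ((∀ r ∈ Set.uIcc 0 ξ, radicand b α k lam (-y) r ≠ 0) →
        c * waveProfile b α k lam y ξ 0 1 = ρ * Complex.exp (phase b α k lam (-y) ξ) ∧
        c * waveProfile b α k lam y ξ 1 0
          = -(ρ * Complex.exp (-phase b α k lam (-y) ξ))) := by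
    intro ξ
    by_cases hξ : ∀ r ∈ Set.uIcc 0 ξ, radicand b α k lam (-y) r ≠ 0
    · have hsq := sq_waveProfile_one_zero h0 h1 hy hreg hξ
      have hmul := mul_offDiag_waveProfile h0 h1 hy fun r (_ : r ∈ Set.uIcc 0 ξ) => hreg r
      have he := Complex.exp_ne_zero (phase b α k lam (-y) ξ)
      have hne := hξ ξ Set.right_mem_uIcc
      have hF : waveProfile b α k lam y ξ 1 0 ≠ 0 := by
        intro h
        rw [h] at hsq
        simp [hne.symm] at hsq
      refine ⟨-(c * waveProfile b α k lam y ξ 1 0 * Complex.exp (phase b α k lam (-y) ξ)),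
        ?_, fun _ => ⟨?_, ?_⟩⟩
      · rw [← hsq, ← hc]; ring
      · rw [← mul_left_inj' (mul_ne_zero hF (hreg 0))]
        linear_combination c * hmul + c * hsq
      · rw [Complex.exp_neg]; field_simp
    -- past a zero of `u² - β₂` the formula imposes nothing, and any root will do
    · obtain ⟨ρ, hρ⟩ := IsAlgClosed.exists_pow_nat_eq (radicand b α k lam (-y) ξ) two_pos
      exact ⟨ρ, hρ, fun h => absurd h hξ⟩
  choose ρ₂ hρ₂ hoff using hroot
  refine ⟨fun ξ => c * amplitude b α k lam y ξ, ρ₂,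
    (wave_isLaxFundamental h0 h1 hy hy0 hreg).const_smul hc0, fun ξ => ?_, hρ₂,
    fun x t _ => ?_, fun x t hr => ?_⟩
  · change _ = radicand b α k lam y ξ
    rw [← amplitude_sq h0 h1 fun r _ => hreg r, ← hc]; ring
  · simp only [Matrix.smul_apply, (wave_diag x t).1, (wave_diag x t).2, smul_eq_mul]
    constructor <;> ring
  · obtain ⟨h01, h10⟩ := hoff _ hr
    simp only [Matrix.smul_apply, wave_apply, smul_eq_mul, ← mul_assoc, h01, h10, theta_eq]
    constructor
    · rw [mul_assoc, ← Complex.exp_add]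
      simp
    · rw [neg_mul, mul_assoc, ← Complex.exp_add]
      simp only [Matrix.cons_val_zero]
      congr 3
      ring

end Existence

/-! ### Uniqueness of the fundamental solution -/

section Uniqueness

variable {b : Background} {α k : ℝ} {lam y : ℂ} {ρ₁ ρ₂ : ℝ → ℂ}
  {Φ : ℝ → ℝ → Matrix (Fin 2) (Fin 2) ℂ}

/-- A solution of the Lax pair forces the root `ρ₁` to be continuous, so it is determined by its
value at `ξ = 0`. -/
lemma IsPhi.root_eq (h : IsPhi b α k lam y ρ₁ ρ₂ Φ) (h0 : 0 < k) (h1 : k < 1)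
    (hreg : ∀ r, radicand b α k lam y r ≠ 0) (ξ : ℝ) :
    ρ₁ ξ = ρ₁ 0 * amplitude b α k lam y ξ := by
  have hφ : Continuous (phase b α k lam y) := continuous_iff_continuousAt.2 fun r =>
    (hasDerivAt_phase h0 h1 fun q _ => hreg q).continuousAt
  have hR : Continuous (amplitude b α k lam y) := continuous_iff_continuousAt.2 fun r =>
    (hasDerivAt_amplitude h0 h1 fun q _ => hreg q).continuousAt
  have hΦ : Continuous fun x => Φ x 0 0 0 := continuous_iff_continuousAt.2 fun x =>
    (h.lax.deriv_x x 0 0 0).continuousAt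
  have hρ : Continuous ρ₁ := by
    have hEq : ρ₁ = fun r => Φ r 0 0 0 * Complex.exp (-phase b α k lam y r) := by
      funext r
      have := (h.diag r 0 fun q _ => hreg q).1
      rw [theta_eq] at this
      rw [this, mul_assoc, ← Complex.exp_add]
      simp
    rw [hEq]
    exact hΦ.mul hφ.neg.cexp
  have hsq : ∀ r, ρ₁ r ^ 2 = radicand b α k lam y r := h.sq₁
  have hne : ∀ r, ρ₁ r ≠ 0 := fun r hr => hreg r (by rw [← hsq, hr]; simp)
  refine isPreconnected_univ.eq_of_sq_eq hρ.continuousOn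
    (continuous_const.mul hR).continuousOn (fun r _ => ?_) (fun {r} _ => ?_)
    (Set.mem_univ (0 : ℝ)) ?_ (Set.mem_univ ξ)
  · simp only [Pi.pow_apply, Pi.mul_apply]
    rw [hsq, mul_pow, hsq, mul_comm, amplitude_sq h0 h1 fun q _ => hreg q]
  · exact mul_ne_zero (hne 0) (amplitude_ne_zero r)
  · simp [amplitude_zero]

/-- If `p f = p g` and the zeros of `p` are simple, then `f = g`. -/
lemma eq_of_mul_eq_mul_of_deriv_ne_zero {p p' : ℝ → ℂ} (hp : ∀ x, HasDerivAt p (p' x) x)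
    (hz : ∀ x, p x = 0 → p' x ≠ 0) {f g : ℝ → ℂ} (hf : Differentiable ℝ f)
    (hg : Differentiable ℝ g) (hfg : ∀ x, p x * f x = p x * g x) (x : ℝ) : f x = g x := by
  by_cases hx : p x = 0
  · have h1 := (hp x).mul (hf x).hasDerivAt
    have h2 := (hp x).mul (hg x).hasDerivAt
    rw [show p * f = p * g from funext hfg] at h1
    have h := h1.unique h2
    simp only [hx, zero_mul, add_zero] at h
    exact mul_left_cancel₀ (hz x hx) h
  · exact mul_left_cancel₀ hx (hfg x)

/-- The diagonal entries are prescribed, and the equation `Φ_x = U Φ` expresses the off-diagonal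
ones through them away from the zeros of the profile, which are simple. -/
lemma IsPhi.eq_smul_wave (h : IsPhi b α k lam y ρ₁ ρ₂ Φ) (hα : α ≠ 0) (h0 : 0 < k) (h1 : k < 1)
    (hy : OnCurve b α k lam y) (hy0 : y ≠ 0)
    (hreg : ∀ r, radicand b α k lam y r ≠ 0) (x t : ℝ) :
    Φ x t = ρ₁ 0 • wave b α k lam y x t := by
  have hw := wave_isLaxFundamental h0 h1 hy hy0 hreg
  have hd0 : ∀ x, Φ x t 0 0 = ρ₁ 0 * wave b α k lam y x t 0 0 := fun x => by
    rw [(h.diag x t fun q _ => hreg q).1, (wave_diag x t).1, h.root_eq h0 h1 hreg]; ring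
  have hd1 : ∀ x, Φ x t 1 1 = ρ₁ 0 * wave b α k lam y x t 1 1 := fun x => by
    rw [(h.diag x t fun q _ => hreg q).2, (wave_diag x t).2, h.root_eq h0 h1 hreg]; ring
  have hp : ∀ x, HasDerivAt (fun x => (bg b α k x t : ℂ))
      (profileDeriv b α k (x - speed b α k * t)) x := fun x =>
    ((hasDerivAt_profile b α h0 h1 _).comp_sub_const x (speed b α k * t)).ofReal_comp
  have hz : ∀ x, (bg b α k x t : ℂ) = 0 →
      (profileDeriv b α k (x - speed b α k * t) : ℂ) ≠ 0 := fun x hx hq => by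
    have he := profileDeriv_sq b α h0 h1 (x - speed b α k * t)
    rw [show profile b α k (x - speed b α k * t) = 0 from Complex.ofReal_eq_zero.1 hx,
      Complex.ofReal_eq_zero.1 hq] at he
    exact energy_ne_zero b α hα h0 h1 (by linarith)
  have hdΦ : ∀ i j, Differentiable ℝ fun x => Φ x t i j := fun i j x =>
    (h.lax.deriv_x x t i j).differentiableAt
  have hdw : ∀ i j, Differentiable ℝ fun x => ρ₁ 0 * wave b α k lam y x t i j := fun i j x =>
    ((hw.deriv_x x t i j).const_mul _).differentiableAt
  have h10 : Φ x t 1 0 = ρ₁ 0 * wave b α k lam y x t 1 0 := by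
    refine eq_of_mul_eq_mul_of_deriv_ne_zero hp hz (hdΦ 1 0) (hdw 1 0) (fun x => ?_) x
    have e1 := h.lax.deriv_x x t 0 0
    rw [funext hd0] at e1
    have e := e1.unique ((hw.deriv_x x t 0 0).const_mul (ρ₁ 0))
    simp [laxU, matQ, sigma3, Matrix.mul_apply, Fin.sum_univ_two, hd0] at e
    linear_combination e
  have h01 : Φ x t 0 1 = ρ₁ 0 * wave b α k lam y x t 0 1 := by
    refine eq_of_mul_eq_mul_of_deriv_ne_zero hp hz (hdΦ 0 1) (hdw 0 1) (fun x => ?_) x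
    have e1 := h.lax.deriv_x x t 1 1
    rw [funext hd1] at e1
    have e := e1.unique ((hw.deriv_x x t 1 1).const_mul (ρ₁ 0))
    simp [laxU, matQ, sigma3, Matrix.mul_apply, Fin.sum_univ_two, hd1] at e
    linear_combination -e
  ext i j
  fin_cases i <;> fin_cases j
  · exact hd0 x
  · exact h01
  · exact h10
  · exact hd1 x

end Uniqueness

/-! ### Limits as the modulus tends to zero

Uniform convergence in `ξ` to a constant is expressed as convergence along the product of the
filter of the moduli with the top filter of the real line. -/

section Limits

lemma eventually_forall_of_prod_top {l : Filter ℝ} {p : ℝ × ℝ → Prop}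
    (h : ∀ᶠ z in l ×ˢ (⊤ : Filter ℝ), p z) : ∀ᶠ k in l, ∀ r, p (k, r) := by
  rw [← principal_univ, eventually_prod_principal_iff] at h
  simpa using h

lemma tendsto_integral_of_uniform_const {l : Filter ℝ} {f : ℝ → ℝ → ℂ} {C : ℂ} {a : ℝ → ℝ}
    {a₀ : ℝ} (hf : Tendsto (fun z : ℝ × ℝ => f z.1 z.2) (l ×ˢ ⊤) (𝓝 C))
    (hc : ∀ᶠ k in l, Continuous (f k)) (ha : Tendsto a l (𝓝 a₀)) :
    Tendsto (fun k => ∫ r in (0 : ℝ)..a k, f k r) l (𝓝 (C * a₀)) := by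
  have hsub : Tendsto (fun k => ∫ r in (0 : ℝ)..a k, (f k r - C)) l (𝓝 0) := by
    rw [Metric.tendsto_nhds]
    intro ε hε
    -- on the bounded intervals `[0, a k]` an error `δ` of the integrand suffices
    set δ := ε / (|a₀| + 2) with hδ
    have hM : 0 < |a₀| + 2 := by positivity
    have h1 := eventually_forall_of_prod_top
      ((Metric.tendsto_nhds.1 hf) δ (div_pos hε hM))
    have h2 : ∀ᶠ k in l, |a k| < |a₀| + 1 := ha.abs.eventually_lt_const (by linarith)
    filter_upwards [h1, h2] with k hk1 hk2
    have h := intervalIntegral.norm_integral_le_of_norm_le_const (a := 0) (b := a k)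
      (f := fun r => f k r - C) (C := δ) fun r _ => by
        simpa [dist_eq_norm] using (hk1 r).le
    rw [dist_zero_right]
    refine h.trans_lt ?_
    rw [sub_zero, hδ, div_mul_eq_mul_div, div_lt_iff₀ hM]
    gcongr
    linarith
  have hlim : Tendsto (fun k => C * (a k : ℂ)) l (𝓝 (C * a₀)) :=
    ((Complex.continuous_ofReal.tendsto _).comp ha).const_mul C
  have h := hsub.add hlim
  rw [zero_add] at h
  refine h.congr' ?_
  filter_upwards [hc] with k hk
  rw [intervalIntegral.integral_sub (hk.intervalIntegrable _ _) (by simp)]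
  simp [mul_comm]

lemma eventually_modulus : ∀ᶠ k in 𝓝[>] (0 : ℝ), 0 < k ∧ k < 1 :=
  Ioo_mem_nhdsGT one_pos

/-- The constant profile to which `u` degenerates. -/
def limitProfile : Background → ℝ → ℝ
  | .cnType, _ => 0
  | .dnType, α => α

/-- The velocity in the limit. -/
def limitSpeed : Background → ℝ → ℝ
  | .cnType, α => -α ^ 2
  | .dnType, α => 2 * α ^ 2

lemma tendsto_speed (b : Background) (α : ℝ) :
    Tendsto (speed b α) (𝓝[>] 0) (𝓝 (limitSpeed b α)) := by
  have h : Continuous (speed b α) := by cases b <;> unfold speed <;> fun_prop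
  have h0 : speed b α 0 = limitSpeed b α := by
    cases b <;> simp [speed, limitSpeed, mul_comm]
  rw [← h0]
  exact (h.tendsto 0).mono_left nhdsWithin_le_nhds

lemma tendsto_zero_of_abs_le_mul {f : ℝ × ℝ → ℝ} {C : ℝ}
    (hf : ∀ k r, 0 < k → k < 1 → |f (k, r)| ≤ C * k) :
    Tendsto f (𝓝[>] (0 : ℝ) ×ˢ ⊤) (𝓝 0) := by
  have hk : Tendsto (fun z : ℝ × ℝ => C * z.1) (𝓝[>] (0 : ℝ) ×ˢ ⊤) (𝓝 0) := by
    have h : Tendsto (fun z : ℝ × ℝ => z.1) (𝓝[>] (0 : ℝ) ×ˢ (⊤ : Filter ℝ)) (𝓝 0) :=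
      tendsto_fst.mono_right nhdsWithin_le_nhds
    simpa using h.const_mul C
  refine squeeze_zero_norm' ?_ hk
  filter_upwards [tendsto_fst.eventually eventually_modulus] with z hz
  exact hf z.1 z.2 hz.1 hz.2

lemma tendsto_profile (b : Background) (α : ℝ) :
    Tendsto (fun z : ℝ × ℝ => profile b α z.1 z.2) (𝓝[>] (0 : ℝ) ×ˢ ⊤)
      (𝓝 (limitProfile b α)) := by
  rw [← tendsto_sub_nhds_zero_iff]
  refine tendsto_zero_of_abs_le_mul (C := |α|) fun k r h0 h1 => ?_
  cases b with
  | cnType =>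
    simp only [profile, limitProfile, sub_zero, abs_mul, abs_of_pos h0]
    exact mul_le_of_le_one_right (by positivity) (Real.abs_cos_le_one _)
  | dnType =>
    have hd := dn_pos h0 h1 (α * r)
    have hd2 := dn_sq h0 h1 (α * r)
    have hs := Real.sin_sq_le_one (am k (α * r))
    have hks : k ^ 2 * Real.sin (am k (α * r)) ^ 2 ≤ k := by nlinarith [sq_nonneg k]
    have hks0 : 0 ≤ k ^ 2 * Real.sin (am k (α * r)) ^ 2 := by positivity
    have hle : |dn k (α * r) - 1| ≤ k := by
      rw [abs_le]; constructor <;> nlinarith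
    simp only [profile, limitProfile]
    rw [← mul_sub_one, abs_mul]
    exact mul_le_mul_of_nonneg_left hle (abs_nonneg α)

lemma tendsto_profileDeriv (b : Background) (α : ℝ) :
    Tendsto (fun z : ℝ × ℝ => profileDeriv b α z.1 z.2) (𝓝[>] (0 : ℝ) ×ˢ ⊤) (𝓝 0) := by
  refine tendsto_zero_of_abs_le_mul (C := α ^ 2) fun k r h0 h1 => ?_
  have hs := Real.abs_sin_le_one (am k (α * r))
  cases b with
  | cnType =>
    have hd : |dn k (α * r)| ≤ 1 := by
      rw [abs_le_one_iff_mul_self_le_one, ← sq, dn_sq h0 h1]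
      nlinarith [mul_nonneg (sq_nonneg k) (sq_nonneg (Real.sin (am k (α * r))))]
    simp only [profileDeriv, abs_neg]
    rw [mul_assoc, abs_mul, abs_of_nonneg (by positivity : 0 ≤ α ^ 2 * k), abs_mul]
    exact mul_le_of_le_one_right (by positivity) (mul_le_one₀ hs (abs_nonneg _) hd)
  | dnType =>
    have hc := Real.abs_cos_le_one (am k (α * r))
    simp only [profileDeriv, abs_neg]
    rw [mul_assoc, abs_mul, abs_of_nonneg (by positivity : 0 ≤ α ^ 2 * k ^ 2), abs_mul]
    refine (mul_le_of_le_one_right (by positivity) (mul_le_one₀ hs (abs_nonneg _) hc)).trans ?_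
    gcongr
    nlinarith

variable {b : Background} {α : ℝ} {lam y₀ : ℂ} {y : ℝ → ℂ}

/-- The limit of `β₁`. -/
def limitBeta (b : Background) (α : ℝ) (lam y₀ : ℂ) : ℂ :=
  2 * lam ^ 2 + (limitSpeed b α : ℂ) / 2 - 2 * y₀

/-- The limit of `u² - β₁`. -/
def limitRadicand (b : Background) (α : ℝ) (lam y₀ : ℂ) : ℂ :=
  (limitProfile b α : ℂ) ^ 2 - limitBeta b α lam y₀

/-- The limit of `θ₁`. -/
def limitTheta (b : Background) (α : ℝ) (lam y₀ : ℂ) (x t : ℝ) : ℂ :=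
  (2 * Complex.I * lam * limitBeta b α lam y₀ / limitRadicand b α lam y₀ + Complex.I * lam)
    * ((x - limitSpeed b α * t : ℝ) : ℂ) + 4 * Complex.I * lam * y₀ * t

lemma tendsto_beta (hy : Tendsto y (𝓝[>] 0) (𝓝 y₀)) :
    Tendsto (fun k => beta b α k lam (y k)) (𝓝[>] 0) (𝓝 (limitBeta b α lam y₀)) :=
  ((((Complex.continuous_ofReal.tendsto _).comp (tendsto_speed b α)).div_const 2).const_add
    _).sub (hy.const_mul 2)

lemma tendsto_radicand (hy : Tendsto y (𝓝[>] 0) (𝓝 y₀)) :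
    Tendsto (fun z : ℝ × ℝ => radicand b α z.1 lam (y z.1) z.2) (𝓝[>] (0 : ℝ) ×ˢ ⊤)
      (𝓝 (limitRadicand b α lam y₀)) :=
  (((Complex.continuous_ofReal.tendsto _).comp (tendsto_profile b α)).pow 2).sub
    ((tendsto_beta hy).comp tendsto_fst)

lemma eventually_radicand_ne_zero (hy : Tendsto y (𝓝[>] 0) (𝓝 y₀))
    (hne : limitRadicand b α lam y₀ ≠ 0) :
    ∀ᶠ k in 𝓝[>] (0 : ℝ), ∀ r, radicand b α k lam (y k) r ≠ 0 :=
  eventually_forall_of_prod_top ((tendsto_radicand hy).eventually_ne hne)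

lemma tendsto_xi (b : Background) (α x t : ℝ) :
    Tendsto (fun k => x - speed b α k * t) (𝓝[>] 0) (𝓝 (x - limitSpeed b α * t)) :=
  ((tendsto_speed b α).mul_const t).const_sub x

/-- Evaluation at `ξ = x - s t`, where `s` depends on the modulus. -/
lemma tendsto_comp_xi {f : ℝ → ℝ → ℂ} {C : ℂ} {l : Filter ℝ}
    (hf : Tendsto (fun z : ℝ × ℝ => f z.1 z.2) (l ×ˢ ⊤) (𝓝 C)) (ξ : ℝ → ℝ) :
    Tendsto (fun k => f k (ξ k)) l (𝓝 C) :=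
  hf.comp (tendsto_id.prodMk tendsto_top)

lemma tendsto_amplitude (hy : Tendsto y (𝓝[>] 0) (𝓝 y₀))
    (hne : limitRadicand b α lam y₀ ≠ 0) (x t : ℝ) :
    Tendsto (fun k => amplitude b α k lam (y k) (x - speed b α k * t)) (𝓝[>] 0) (𝓝 1) := by
  have hf := (((Complex.continuous_ofReal.tendsto _).comp (tendsto_profile b α)).mul
    ((Complex.continuous_ofReal.tendsto _).comp (tendsto_profileDeriv b α))).div
      (tendsto_radicand (lam := lam) hy) hne
  have h := tendsto_integral_of_uniform_const
    (f := fun k r => (profile b α k r : ℂ) * profileDeriv b α k r / radicand b α k lam (y k) r)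
    hf ?_ (tendsto_xi b α x t)
  · simpa [amplitude] using h.cexp
  · filter_upwards [eventually_modulus, eventually_radicand_ne_zero hy hne] with k ⟨h0, h1⟩ hreg
    exact ((Complex.continuous_ofReal.comp (continuous_profile b α h0 h1)).mul
      (Complex.continuous_ofReal.comp (continuous_profileDeriv b α h0 h1))).div
        (continuous_radicand h0 h1) hreg

lemma tendsto_theta (hy : Tendsto y (𝓝[>] 0) (𝓝 y₀))
    (hne : limitRadicand b α lam y₀ ≠ 0) (x t : ℝ) :
    Tendsto (fun k => theta b α k lam (y k) x t) (𝓝[>] 0)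
      (𝓝 (limitTheta b α lam y₀ x t)) := by
  have hf := (((tendsto_beta (b := b) (α := α) (lam := lam) hy).const_mul
    (2 * Complex.I * lam)).comp tendsto_fst).div (tendsto_radicand (lam := lam) hy) hne
  have h := tendsto_integral_of_uniform_const
    (f := fun k r => 2 * Complex.I * lam * beta b α k lam (y k) / radicand b α k lam (y k) r)
    hf ?_ (tendsto_xi b α x t)
  · have hξ := (((Complex.continuous_ofReal.tendsto _).comp (tendsto_xi b α x t)).const_mul
      (Complex.I * lam))
    have hyt := (hy.const_mul (4 * Complex.I * lam)).mul_const (t : ℂ)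
    rw [limitTheta, add_mul]
    exact (h.add hξ).add hyt
  · filter_upwards [eventually_modulus, eventually_radicand_ne_zero hy hne] with k ⟨h0, h1⟩ hreg
    exact continuous_const.div (continuous_radicand h0 h1) hreg

lemma wave_eq (k : ℝ) (y : ℂ) (x t : ℝ) :
    wave b α k lam y x t =
      let ξ := x - speed b α k * t
      let m := fun ε : ℂ => (profileDeriv b α k ξ + ε * (2 * Complex.I * lam * profile b α k ξ))
        / radicand b α k lam y ξ
      let R := amplitude b α k lam y ξ
      let θ := theta b α k lam y x t
      !![R * Complex.exp θ, m (-1) * (R * Complex.exp (-θ));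
         m 1 * (R * Complex.exp θ), -(R * Complex.exp (-θ))] := by
  have e1 : Complex.exp (theta b α k lam y x t)
      = Complex.exp (phase b α k lam y (x - speed b α k * t))
        * Complex.exp (4 * Complex.I * lam * y * t) := by rw [theta_eq, Complex.exp_add]
  have e2 : Complex.exp (-theta b α k lam y x t)
      = Complex.exp (-phase b α k lam y (x - speed b α k * t))
        * Complex.exp (-(4 * Complex.I * lam * y) * t) := by
    rw [theta_eq, neg_add, Complex.exp_add, neg_mul]
  ext i j
  simp only [wave_apply, waveProfile, e1, e2]
  fin_cases i <;> fin_cases j <;> simp [sub_eq_add_neg, mul_assoc]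

/-- The limit of `wave * sigma3`. -/
def limitWave (b : Background) (α : ℝ) (lam y₀ : ℂ) (x t : ℝ) : Matrix (Fin 2) (Fin 2) ℂ :=
  let m := 2 * Complex.I * lam * limitProfile b α / limitRadicand b α lam y₀
  let θ := limitTheta b α lam y₀ x t
  !![Complex.exp θ, m * Complex.exp (-θ); m * Complex.exp θ, Complex.exp (-θ)]

lemma tendsto_wave (hy : Tendsto y (𝓝[>] 0) (𝓝 y₀))
    (hne : limitRadicand b α lam y₀ ≠ 0) (x t : ℝ) :
    Tendsto (fun k => wave b α k lam (y k) x t * sigma3) (𝓝[>] 0)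
      (𝓝 (limitWave b α lam y₀ x t)) := by
  have hR := tendsto_amplitude (lam := lam) hy hne x t
  have hθ := tendsto_theta (lam := lam) hy hne x t
  have hm : ∀ ε : ℂ, Tendsto (fun k =>
      ((profileDeriv b α k (x - speed b α k * t) : ℂ)
        + ε * (2 * Complex.I * lam * profile b α k (x - speed b α k * t)))
        / radicand b α k lam (y k) (x - speed b α k * t)) (𝓝[>] 0)
      (𝓝 ((0 + ε * (2 * Complex.I * lam * limitProfile b α)) / limitRadicand b α lam y₀)) := by
    intro ε
    refine tendsto_comp_xi (f := fun k ξ => ((profileDeriv b α k ξ : ℂ)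
        + ε * (2 * Complex.I * lam * profile b α k ξ)) / radicand b α k lam (y k) ξ) ?_ _
    refine Tendsto.div (Tendsto.add ?_ ?_) (tendsto_radicand hy) hne
    · exact (Complex.continuous_ofReal.tendsto' 0 0 Complex.ofReal_zero).comp
        (tendsto_profileDeriv b α)
    · exact (((Complex.continuous_ofReal.tendsto _).comp (tendsto_profile b α)).const_mul
        _).const_mul ε
  refine tendsto_pi_nhds.2 fun i => tendsto_pi_nhds.2 fun j => ?_
  simp only [wave_eq, limitWave]
  fin_cases i <;> fin_cases j
  · simpa [sigma3] using hR.mul hθ.cexp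
  · simpa [sigma3, neg_div] using ((hm (-1)).mul (hR.mul hθ.neg.cexp)).neg
  · simpa [sigma3] using (hm 1).mul (hR.mul hθ.cexp)
  · simpa [sigma3] using hR.mul hθ.neg.cexp

/-- Both limits are instances of this one: if the limits of `y` and of `u² - β₁` are nonzero, then
`Φ` exists for small `k` and the normalised matrix converges to `limitWave`. -/
lemma normalisedLimit_limitWave (hα : α ≠ 0)
    (hcurve : ∀ᶠ k in 𝓝[>] (0 : ℝ), OnCurve b α k lam (y k))
    (hy : Tendsto y (𝓝[>] 0) (𝓝 y₀)) (hy₀ : y₀ ≠ 0)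
    (hne : limitRadicand b α lam y₀ ≠ 0) :
    NormalisedLimit b α lam y (limitWave b α lam y₀) := by
  have hreg := eventually_radicand_ne_zero hy hne
  have hy0 := hy.eventually_ne hy₀
  constructor
  · filter_upwards [eventually_modulus, hcurve, hreg, hy0] with k ⟨h0, h1⟩ hc hr hk
    obtain ⟨c, hc2⟩ := IsAlgClosed.exists_pow_nat_eq (radicand b α k lam (y k) 0) two_pos
    obtain ⟨ρ₁, ρ₂, h⟩ := isPhi_smul_wave h0 h1 hc hk hr hc2
    exact ⟨ρ₁, ρ₂, _, h⟩
  · intro ρ₁ ρ₂ Φ hΦ x t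
    refine (tendsto_wave hy hne x t).congr' ?_
    filter_upwards [eventually_modulus, hcurve, hreg, hy0, hΦ] with k ⟨h0, h1⟩ hc hr hk h
    have hρ : ρ₁ k 0 ≠ 0 := fun h' => hr 0 (by rw [radicand, ← h.sq₁, h']; simp)
    rw [h.eq_smul_wave hα h0 h1 hc hk hr, Matrix.smul_mul, smul_smul, inv_mul_cancel₀ hρ,
      one_smul]

end Limits

/-! ### The limiting matrices -/

lemma limitRadicand_cnType (α : ℝ) (lam : ℂ) :
    limitRadicand .cnType α lam (-(lam ^ 2 - (α : ℂ) ^ 2 / 4)) = (α : ℂ) ^ 2 - 4 * lam ^ 2 := by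
  simp only [limitRadicand, limitBeta, limitProfile, limitSpeed]
  push_cast
  ring

lemma limitWave_cnType {α : ℝ} {lam : ℂ} (hne : (α : ℂ) ^ 2 - 4 * lam ^ 2 ≠ 0) :
    limitWave .cnType α lam (-(lam ^ 2 - (α : ℂ) ^ 2 / 4)) = zeroBackgroundPsi lam := by
  funext x t
  have hθ : limitTheta .cnType α lam (-(lam ^ 2 - (α : ℂ) ^ 2 / 4)) x t
      = -(Complex.I * lam * x) - 4 * Complex.I * lam ^ 3 * t := by
    have hc : 2 * Complex.I * lam * limitBeta .cnType α lam (-(lam ^ 2 - (α : ℂ) ^ 2 / 4))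
        / ((α : ℂ) ^ 2 - 4 * lam ^ 2) + Complex.I * lam = -(Complex.I * lam) := by
      rw [div_add' _ _ _ hne, div_eq_iff hne]
      simp only [limitBeta, limitSpeed]
      push_cast
      ring
    rw [limitTheta, limitRadicand_cnType, hc]
    simp only [limitSpeed]
    push_cast
    ring
  simp only [limitWave, zeroBackgroundPsi, hθ]
  congr 3 <;> simp [limitProfile]
  ring_nf

lemma nu_sq (α : ℝ) (lam : ℂ) : nu α lam ^ 2 = -lam ^ 2 - (α : ℂ) ^ 2 := by
  rw [nu, one_div]
  exact Complex.cpow_ofNat_inv_pow _ 2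

lemma nu_add_ne_zero {α : ℝ} (hα : α ≠ 0) (lam : ℂ) : nu α lam + Complex.I * lam ≠ 0 := by
  intro h
  have h2 := nu_sq α lam
  have hα' : (α : ℂ) ^ 2 ≠ 0 := by simpa using hα
  refine hα' ?_
  linear_combination h2 - (nu α lam - Complex.I * lam) * h - lam ^ 2 * Complex.I_sq

lemma limitRadicand_dnType (α : ℝ) (lam : ℂ) :
    limitRadicand .dnType α lam (Complex.I * lam * nu α lam)
      = 2 * Complex.I * lam * (nu α lam + Complex.I * lam) := by
  simp only [limitRadicand, limitBeta, limitProfile, limitSpeed]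
  push_cast
  linear_combination -2 * lam ^ 2 * Complex.I_sq

lemma limitWave_dnType {α : ℝ} (hα : α ≠ 0) {lam : ℂ} (hlam : lam ≠ 0) :
    limitWave .dnType α lam (Complex.I * lam * nu α lam) = constBackgroundPsi α lam := by
  funext x t
  have hs := nu_add_ne_zero hα lam
  have h2 := nu_sq α lam
  have hI := Complex.I_sq
  have hI0 := Complex.I_ne_zero
  have hθ : limitTheta .dnType α lam (Complex.I * lam * nu α lam) x t
      = -(nu α lam * (x + 2 * (2 * lam ^ 2 - (α : ℂ) ^ 2) * t)) := by
    have hc : 2 * Complex.I * lam * limitBeta .dnType α lam (Complex.I * lam * nu α lam)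
        / (2 * Complex.I * lam * (nu α lam + Complex.I * lam)) + Complex.I * lam
        = -nu α lam := by
      rw [mul_div_mul_left _ _ (by simp [hlam]), div_add' _ _ _ hs, div_eq_iff hs]
      simp only [limitBeta, limitSpeed]
      push_cast
      linear_combination h2 + lam ^ 2 * hI
    rw [limitTheta, limitRadicand_dnType, hc]
    simp only [limitSpeed]
    push_cast
    linear_combination 4 * lam ^ 2 * nu α lam * t * hI
  have hm : 2 * Complex.I * lam * α / (2 * Complex.I * lam * (nu α lam + Complex.I * lam))
      = α / (nu α lam + Complex.I * lam) := mul_div_mul_left _ _ (by simp [hlam])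
  simp only [limitWave, constBackgroundPsi, hθ, limitRadicand_dnType, limitProfile, hm, neg_neg,
    div_mul_eq_mul_div]

end EllipticMKdV

end

theorem mainTheorem6 (α : ℝ) (hα : α ≠ 0) (lam : ℂ) :
    (lam ≠ (α : ℂ) / 2 → lam ≠ -((α : ℂ) / 2) →
      ∀ y : ℝ → ℂ,
        (∀ᶠ k in 𝓝[>] (0 : ℝ), EllipticMKdV.OnCurve .cnType α k lam (y k)) →
        Tendsto y (𝓝[>] 0) (𝓝 (-(lam ^ 2 - (α : ℂ) ^ 2 / 4))) →
        EllipticMKdV.NormalisedLimit .cnType α lam y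
          (EllipticMKdV.zeroBackgroundPsi lam)) ∧
    (lam.re = 0 → |α| < |lam.im| →
      ∀ y : ℝ → ℂ,
        (∀ᶠ k in 𝓝[>] (0 : ℝ), EllipticMKdV.OnCurve .dnType α k lam (y k)) →
        Tendsto y (𝓝[>] 0) (𝓝 (Complex.I * lam * EllipticMKdV.nu α lam)) →
        EllipticMKdV.NormalisedLimit .dnType α lam y
          (EllipticMKdV.constBackgroundPsi α lam)) := by
  constructor
  · intro h1 h2 y hc hy
    have hne : (α : ℂ) ^ 2 - 4 * lam ^ 2 ≠ 0 := by
      rw [show (α : ℂ) ^ 2 - 4 * lam ^ 2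
        = -4 * ((lam - (α : ℂ) / 2) * (lam - -((α : ℂ) / 2))) by ring]
      exact mul_ne_zero (by norm_num) (mul_ne_zero (sub_ne_zero.2 h1) (sub_ne_zero.2 h2))
    rw [← EllipticMKdV.limitWave_cnType hne]
    refine EllipticMKdV.normalisedLimit_limitWave hα hc hy (fun h => hne ?_)
      (by rwa [EllipticMKdV.limitRadicand_cnType])
    linear_combination 4 * h
  · intro hre him y hc hy
    have hlam : lam ≠ 0 := by
      rintro rfl
      exact (abs_nonneg α).not_gt (by simpa using him)
    have hν : EllipticMKdV.nu α lam ≠ 0 := by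
      intro h
      -- `ν = 0` would mean `λ² = -α²`, but `-λ² = (Im λ)² > α²`
      have h2 := congrArg Complex.re (EllipticMKdV.nu_sq α lam)
      rw [h] at h2
      simp [sq, hre] at h2
      have h3 := sq_lt_sq.2 him
      nlinarith
    rw [← EllipticMKdV.limitWave_dnType hα hlam]
    refine EllipticMKdV.normalisedLimit_limitWave hα hc hy (by simp [hlam, hν]) ?_
    rw [EllipticMKdV.limitRadicand_dnType]
    exact mul_ne_zero (by simp [hlam]) (EllipticMKdV.nu_add_ne_zero hα lam)
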